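/- **Setting.** A *pomset* over an alphabet $\Sigma$ is an isomorphism class of finite $\Sigma$-labelled posets (isomorphisms are bijections preserving labels and preserving and reflecting the order). $1$ is the empty pomset and $a\in\Sigma$ also denotes the one-node pomset labelled $a$. $U\parallel V$ is the disjoint union without order between the parts, and $U\cdot V$ is the disjoint union in which, moreover, every node of $U$ is below every node of $V$. Series-parallel pomsets are those generated from $1$ and the one-node pomsets by $\cdot$ and $\parallel$. Operations are lifted pointwise to sets of pomsets (languages), with $L^0=\{1\}$, $L^{n+1}=L^n\cdot L$ and $L^*=\bigcup_{n\in\mathbb N}L^n$. *Terms* over $\Sigma$ are generated by $e,f::=0\mid 1\mid a\in\Sigma\mid e+f\mid e\cdot f\mid e\parallel f\mid e^*$. Their BKA-semantics is $[\![0]\!]=\emptyset$, $[\![1]\!]=\{1\}$, $[\![a]\!]=\{a\}$, $[\![e+f]\!]=[\![e]\!]\cup[\![f]\!]$, and likewise homomorphically for $\cdot,\parallel,{}^*$. A *context* $C$ is a series-parallel pomset over $\Sigma$ with exactly one additional gap node; $C[U]$ is the result of inserting $U$ into the gap, and $C[L]=\{C[U]\mid U\in L\}$. For a set $H$ of hypotheses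 $e\le f$ between terms, the $H$-*closure* of a language $L$ is the smallest language $K\supseteq L$ such that, for all $(e\le f)\in H$ and all contexts $C$, $C[[\![f]\!]]\subseteq K$ implies $C[[\![e]\!]]\subseteq K$. Let $\mathrm{Var}=\{x,y,r_0,r_1\}$ (four distinct variables) and $\mathrm{Val}=\{0,1\}$. Let $\mathsf{Act}$ consist of the assignments $v\leftarrow n$ and $v\leftarrow v'$ with $v,v'\in\mathrm{Var}$, $n\in\mathrm{Val}$, and let $\mathsf{State}$ be the set of partial functions $\mathrm{Var}\rightharpoonup\mathrm{Val}$, ordered by $\alpha\le\beta$ iff $\alpha$ extends $\beta$. *Observations* are $p,q::=\bot\mid\top\mid (v=n)\mid p\vee q\mid p\wedge q\mid\overline p$, interpreted as downwards-closed sets of states: $[\![v=n]\!]=\{\alpha\mid\alpha(v)=n\}$; $\bot,\top,\vee,\wedge$ are interpreted as $\emptyset,\mathsf{State},\cup,\cap$; and $[\![\overline p]\!]$ is the union of all downwards-closed sets of states disjoint from $[\![p]\!]$. *POCKA terms* are the terms over $\mathsf{Act}\cup\{\text{observations}\}$. Their unclosed semantics $(\!|e|\!)$, a language over $\mathsf{Act}\cup\mathsf{State}$,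 is given by $(\!|a|\!)=\mathsf{State}^*\cdot\{a\}\cdot\mathsf{State}^*$ for $a\in\mathsf{Act}$ and $(\!|p|\!)=\mathsf{State}^*\cdot[\![p]\!]\cdot\mathsf{State}^*$ for observations $p$, extended homomorphically to all terms. The *POCKA semantics* of $e$ is the $(\mathsf{exch}\cup\mathsf{contr})$-closure of $(\!|e|\!)$, where $\mathsf{exch}=\{(e\parallel f)\cdot(g\parallel h)\le(e\cdot g)\parallel(f\cdot h)\}$ for all terms $e,f,g,h$ over $\mathsf{Act}\cup\mathsf{State}$, and $\mathsf{contr}=\{\alpha\le\alpha\cdot\alpha\mid\alpha\in\mathsf{State}\}$. For $\alpha\in\mathsf{State}$, the state $\alpha[v\leftarrow n]$ always exists and sends $v$ to $n$; $\alpha[v\leftarrow v']$ exists iff $v'\in\mathrm{dom}(\alpha)$, and then sends $v$ to $\alpha(v')$; both agree with $\alpha$ on all other variables. $\alpha\oplus\beta$ is defined iff $\alpha$ and $\beta$ agree on $\mathrm{dom}(\alpha)\cap\mathrm{dom}(\beta)$, and is then $\alpha\cup\beta$. The set $\mathcal G$ of *guarded pomsets* is the smallest set of pomsets over $\mathsf{Act}\cup\mathsf{State}$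 such that, for all states $\alpha,\beta,\gamma,\delta$, actions $a$ and pomsets $U,V$: - $\alpha\in\mathcal G$; - if $\alpha[a]$ exists, then $\alpha\cdot a\cdot\alpha[a]\in\mathcal G$; - if $U\cdot\alpha\in\mathcal G$ and $\alpha\cdot V\in\mathcal G$, then $U\cdot\alpha\cdot V\in\mathcal G$; - if $\alpha\cdot U\cdot\beta\in\mathcal G$, $\gamma\cdot V\cdot\delta\in\mathcal G$, and $\alpha\oplus\gamma$ and $\beta\oplus\delta$ are defined, then $(\alpha\oplus\gamma)\cdot(U\parallel V)\cdot(\beta\oplus\delta)\in\mathcal G$. **Statement.** Let $t$ be the store-buffering litmus term $$t=(r_0=0\wedge r_1=0)\cdot\big((x\leftarrow 1\cdot r_0\leftarrow y)\parallel(y\leftarrow 1\cdot r_1\leftarrow x)\big)\cdot\overline{(r_0=1\vee r_1=1)}.$$ Then the POCKA semantics of $t$ contains no guarded pomset: its intersection with $\mathcal G$ is empty. -/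

import Mathlib

namespace Pocka

/-! ### Labelled posets and pomsets -/

/-- A labelled poset over the alphabet `A`: a finite partially ordered carrier with a labelling. -/
structure LPoset (A : Type) : Type 1 where
  carrier : Type
  order : PartialOrder carrier
  finite : Finite carrier
  label : carrier → A

attribute [instance] LPoset.order LPoset.finite

/-- Isomorphism of labelled posets: a bijection that preserves labels and preserves and reflects
the order. -/
def LPoset.Iso {A : Type} (u v : LPoset A) : Prop :=
  ∃ h : u.carrier ≃o v.carrier, ∀ s, v.label (h s) = u.label s

theorem LPoset.Iso.equivalence (A : Type) : Equivalence (LPoset.Iso (A := A)) where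
  refl _ := ⟨OrderIso.refl _, fun _ => rfl⟩
  symm := by
    rintro u v ⟨h, hl⟩
    exact ⟨h.symm, fun s => by rw [← hl (h.symm s), h.apply_symm_apply]⟩
  trans := by
    rintro u v w ⟨h, hl⟩ ⟨k, kl⟩
    exact ⟨h.trans k, fun s => by rw [OrderIso.trans_apply, kl, hl]⟩

instance LPoset.setoid (A : Type) : Setoid (LPoset A) :=
  ⟨LPoset.Iso, LPoset.Iso.equivalence A⟩

/-- Pomsets: isomorphism classes of labelled posets. -/
def Pomset (A : Type) : Type 1 := Quotient (LPoset.setoid A)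

/-- The empty labelled poset. -/
def LPoset.empty (A : Type) : LPoset A where
  carrier := Fin 0
  order := inferInstance
  finite := inferInstance
  label := Fin.elim0

/-- The one-element labelled poset with label `a`. -/
def LPoset.single {A : Type} (a : A) : LPoset A where
  carrier := Unit
  order := inferInstance
  finite := inferInstance
  label := fun _ => a

/-- Parallel composition: the disjoint union of the carriers, with no order between the parts. -/
def LPoset.par {A : Type} (u v : LPoset A) : LPoset A where
  carrier := u.carrier ⊕ v.carrier
  order := inferInstance
  finite := inferInstance
  label := Sum.elim u.label v.label

/-- Sequential composition: the disjoint union of the carriers, with every element of the left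
part below every element of the right part (`⊕ₗ` is the lexicographic sum). -/
def LPoset.seq {A : Type} (u v : LPoset A) : LPoset A where
  carrier := u.carrier ⊕ₗ v.carrier
  order := inferInstance
  finite := inferInstanceAs (Finite (u.carrier ⊕ v.carrier))
  label := fun s => Sum.elim u.label v.label (ofLex s)

theorem LPoset.par_iso {A : Type} {u u' v v' : LPoset A} (hu : u ≈ u') (hv : v ≈ v') :
    u.par v ≈ u'.par v' := by
  obtain ⟨h, hl⟩ := hu
  obtain ⟨k, kl⟩ := hv
  refine ⟨OrderIso.sumCongr h k, ?_⟩
  rintro (s | s)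
  · exact hl s
  · exact kl s

theorem LPoset.seq_iso {A : Type} {u u' v v' : LPoset A} (hu : u ≈ u') (hv : v ≈ v') :
    u.seq v ≈ u'.seq v' := by
  obtain ⟨h, hl⟩ := hu
  obtain ⟨k, kl⟩ := hv
  refine ⟨OrderIso.sumLexCongr h k, ?_⟩
  rintro (s | s)
  · exact hl s
  · exact kl s

namespace Pomset

/-- The empty pomset `1`. -/
def one {A : Type} : Pomset A := Quotient.mk _ (LPoset.empty A)

/-- The pomset with a single node, labelled by `a`. -/
def atom {A : Type} (a : A) : Pomset A := Quotient.mk _ (LPoset.single a)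

/-- Parallel composition `U ∥ V` of pomsets. -/
def par {A : Type} : Pomset A → Pomset A → Pomset A :=
  Quotient.map₂ LPoset.par fun _ _ hu _ _ hv => LPoset.par_iso hu hv

/-- Sequential composition `U · V` of pomsets. -/
def seq {A : Type} : Pomset A → Pomset A → Pomset A :=
  Quotient.map₂ LPoset.seq fun _ _ hu _ _ hv => LPoset.seq_iso hu hv

/-- Series-parallel pomsets. -/
inductive IsSP {A : Type} : Pomset A → Prop
  | one : IsSP one
  | atom (a : A) : IsSP (atom a)
  | par {U V : Pomset A} : IsSP U → IsSP V → IsSP (par U V)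
  | seq {U V : Pomset A} : IsSP U → IsSP V → IsSP (seq U V)

end Pomset

/-! ### Pomset languages -/

namespace Lang

/-- `L · K`, pointwise. -/
def seq {A : Type} (L K : Set (Pomset A)) : Set (Pomset A) := Set.image2 Pomset.seq L K

/-- `L ∥ K`, pointwise. -/
def par {A : Type} (L K : Set (Pomset A)) : Set (Pomset A) := Set.image2 Pomset.par L K

/-- `L ^ 0 = {1}` and `L ^ (n + 1) = L ^ n · L`. -/
def pow {A : Type} (L : Set (Pomset A)) : ℕ → Set (Pomset A)
  | 0 => {Pomset.one}
  | n + 1 => seq (pow L n) L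

/-- The Kleene star of a pomset language. -/
def star {A : Type} (L : Set (Pomset A)) : Set (Pomset A) := ⋃ n : ℕ, pow L n

end Lang

/-! ### Bi-Kleene algebra terms, hypotheses and closure -/

/-- Bi-Kleene algebra terms over the alphabet `A`. -/
inductive Term (A : Type) : Type
  | zero : Term A
  | one : Term A
  | letter : A → Term A
  | plus : Term A → Term A → Term A
  | seq : Term A → Term A → Term A
  | par : Term A → Term A → Term A
  | star : Term A → Term A

/-- The homomorphic extension to terms of an interpretation of the letters by pomset languages. -/
def Term.interp {A B : Type} (φ : A → Set (Pomset B)) : Term A → Set (Pomset B)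
  | zero => ∅
  | one => {Pomset.one}
  | letter a => φ a
  | plus e f => interp φ e ∪ interp φ f
  | seq e f => Lang.seq (interp φ e) (interp φ f)
  | par e f => Lang.par (interp φ e) (interp φ f)
  | star e => Lang.star (interp φ e)

/-- The bi-Kleene algebra semantics: a letter is interpreted by its one-node pomset. -/
def Term.bkaSem {A : Type} : Term A → Set (Pomset A) := Term.interp fun a => {Pomset.atom a}

/-- Pomset contexts, that is, series-parallel pomsets with exactly one gap, presented by the way
in which they are built up around the gap. -/
inductive Ctx (A : Type) : Type 1
  | hole : Ctx A
  | seqLeft (X : Pomset A) (hX : X.IsSP) (C : Ctx A) : Ctx A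
  | seqRight (C : Ctx A) (X : Pomset A) (hX : X.IsSP) : Ctx A
  | par (X : Pomset A) (hX : X.IsSP) (C : Ctx A) : Ctx A

/-- Insertion `C[U]` of a pomset into the gap of a context. -/
def Ctx.fill {A : Type} : Ctx A → Pomset A → Pomset A
  | hole, U => U
  | seqLeft X _ C, U => X.seq (C.fill U)
  | seqRight C X _, U => (C.fill U).seq X
  | par X _ C, U => X.par (C.fill U)

/-- A hypothesis `e ≤ f` between terms. -/
structure Hyp (A : Type) : Type where
  lhs : Term A
  rhs : Term A

/-- The `H`-closure of a pomset language `L`: the smallest language that contains `L` and, for all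
`e ≤ f` in `H` and all contexts `C`, contains `C[⟦e⟧]` as soon as it contains `C[⟦f⟧]`. -/
inductive Closure {A : Type} (H : Set (Hyp A)) (L : Set (Pomset A)) : Pomset A → Prop
  | base {U : Pomset A} : U ∈ L → Closure H L U
  | step {h : Hyp A} (hH : h ∈ H) (C : Ctx A)
      (hf : ∀ U ∈ h.rhs.bkaSem, Closure H L (C.fill U)) {V : Pomset A} (hV : V ∈ h.lhs.bkaSem) :
      Closure H L (C.fill V)

/-- The hypotheses `(e ∥ f) · (g ∥ h) ≤ (e · g) ∥ (f · h)` of the exchange law. -/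
def exch (A : Type) : Set (Hyp A) :=
  {p | ∃ e f g h : Term A,
    p = ⟨.seq (.par e f) (.par g h), .par (.seq e g) (.seq f h)⟩}

/-! ### Actions, states and observations -/

/-- Assignments `v ← n` (`assign v n`) and `v ← v'` (`copy v v'`). -/
inductive Act (Var Val : Type) : Type
  | assign : Var → Val → Act Var Val
  | copy : Var → Var → Act Var Val

/-- States: partial functions from variables to values. -/
abbrev State (Var Val : Type) : Type := Var → Option Val

/-- The order of states, `α ≤ β` iff `α` extends `β`: the domain of `β` is contained in that of `α`
and the two agree on the domain of `β`. -/
def State.Le {Var Val : Type} (α β : State Var Val) : Prop :=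
  ∀ v n, β v = some n → α v = some n

/-- Downwards-closed sets of states. -/
def IsDownClosed {Var Val : Type} (Z : Set (State Var Val)) : Prop :=
  ∀ α β : State Var Val, α.Le β → β ∈ Z → α ∈ Z

/-- Observation terms. -/
inductive Obs (Var Val : Type) : Type
  | bot : Obs Var Val
  | top : Obs Var Val
  | eq : Var → Val → Obs Var Val
  | or : Obs Var Val → Obs Var Val → Obs Var Val
  | and : Obs Var Val → Obs Var Val → Obs Var Val
  | neg : Obs Var Val → Obs Var Val

/-- The semantics of observations in the pseudocomplemented distributive lattice of downwards-closed
sets of states; negation is the pseudocomplement. -/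
def Obs.sem {Var Val : Type} : Obs Var Val → Set (State Var Val)
  | bot => ∅
  | top => Set.univ
  | eq v n => {α | α v = some n}
  | or p q => p.sem ∪ q.sem
  | and p q => p.sem ∩ q.sem
  | neg p => ⋃₀ {Z | IsDownClosed Z ∧ p.sem ∩ Z = ∅}

/-! ### POCKA terms and their semantics -/

/-- POCKA terms: bi-Kleene algebra terms over actions and observations. -/
abbrev PTerm (Var Val : Type) : Type := Term (Act Var Val ⊕ Obs Var Val)

/-- The labels of the pomsets in the semantics: actions and states. -/
abbrev Label (Var Val : Type) : Type := Act Var Val ⊕ State Var Val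

/-- The one-node pomset labelled by an action. -/
def actPom {Var Val : Type} (a : Act Var Val) : Pomset (Label Var Val) := Pomset.atom (Sum.inl a)

/-- The one-node pomset labelled by a state. -/
def statePom {Var Val : Type} (α : State Var Val) : Pomset (Label Var Val) :=
  Pomset.atom (Sum.inr α)

/-- `State* · L · State*`. -/
def padStates {Var Val : Type} (L : Set (Pomset (Label Var Val))) : Set (Pomset (Label Var Val)) :=
  Lang.seq (Lang.seq (Lang.star (Set.range statePom)) L) (Lang.star (Set.range statePom))

/-- The unclosed semantics of POCKA terms. -/
def rsem {Var Val : Type} : PTerm Var Val → Set (Pomset (Label Var Val)) :=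
  Term.interp fun
    | Sum.inl a => padStates {actPom a}
    | Sum.inr p => padStates (statePom '' p.sem)

/-- The contraction hypotheses `α ≤ α · α`, for states `α`. -/
def contr (Var Val : Type) : Set (Hyp (Label Var Val)) :=
  {p | ∃ α : State Var Val,
    p = ⟨.letter (Sum.inr α), .seq (.letter (Sum.inr α)) (.letter (Sum.inr α))⟩}

/-- The POCKA semantics: the closure of the unclosed semantics under exchange and contraction. -/
def pockaSem {Var Val : Type} (e : PTerm Var Val) : Set (Pomset (Label Var Val)) :=
  {U | Closure (exch (Label Var Val) ∪ contr Var Val) (rsem e) U}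

/-! ### Guarded pomsets -/

/-- The updated state `α[a]`; `none` when it does not exist, i.e. when `a` copies the value of a
variable outside the domain of `α`. -/
def State.update {Var Val : Type} [DecidableEq Var] (α : State Var Val) :
    Act Var Val → Option (State Var Val)
  | .assign v n => some fun w => if w = v then some n else α w
  | .copy v v' =>
    match α v' with
    | some n => some fun w => if w = v then some n else α w
    | none => none

/-- `α ⊕ β` is defined: the two states agree on the common part of their domains. -/
def State.Compatible {Var Val : Type} (α β : State Var Val) : Prop :=
  ∀ v m n, α v = some m → β v = some n → m = n

/-- `α ⊕ β`, the union of two partial functions (used only for compatible states). -/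
def State.union {Var Val : Type} (α β : State Var Val) : State Var Val :=
  fun v => (α v).or (β v)

/-- Guarded pomsets. -/
inductive Guarded {Var Val : Type} [DecidableEq Var] : Pomset (Label Var Val) → Prop
  | state (α : State Var Val) : Guarded (statePom α)
  | action (α : State Var Val) (a : Act Var Val) (β : State Var Val) (h : α.update a = some β) :
      Guarded (((statePom α).seq (actPom a)).seq (statePom β))
  | seq (U V : Pomset (Label Var Val)) (α : State Var Val)
      (hU : Guarded (U.seq (statePom α))) (hV : Guarded ((statePom α).seq V)) :
      Guarded ((U.seq (statePom α)).seq V)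
  | par (U V : Pomset (Label Var Val)) (α β γ δ : State Var Val)
      (hU : Guarded (((statePom α).seq U).seq (statePom β)))
      (hV : Guarded (((statePom γ).seq V).seq (statePom δ)))
      (hαγ : α.Compatible γ) (hβδ : β.Compatible δ) :
      Guarded (((statePom (α.union γ)).seq (U.par V)).seq (statePom (β.union δ)))

/-- The set of guarded pomsets. -/
def guardedPomsets (Var Val : Type) [DecidableEq Var] : Set (Pomset (Label Var Val)) :=
  {U | Guarded U}

/-! ### The store-buffering litmus test -/

/-- The variables of the litmus test. -/
inductive LVar : Type
  | x
  | y
  | r0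
  | r1
  deriving DecidableEq

/-- The values of the litmus test: `0` and `1`. -/
abbrev LVal : Type := Fin 2

/-- The first thread, `x ← 1 · r0 ← y`. -/
def thread0 : PTerm LVar LVal :=
  .seq (.letter (.inl (.assign .x 1))) (.letter (.inl (.copy .r0 .y)))

/-- The second thread, `y ← 1 · r1 ← x`. -/
def thread1 : PTerm LVar LVal :=
  .seq (.letter (.inl (.assign .y 1))) (.letter (.inl (.copy .r1 .x)))

/-- The litmus test `(r0 = 0 ∧ r1 = 0) · (thread0 ∥ thread1) · ¬(r0 = 1 ∨ r1 = 1)`. -/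
def litmus : PTerm LVar LVal :=
  .seq
    (.seq (.letter (.inr (.and (.eq .r0 0) (.eq .r1 0)))) (.par thread0 thread1))
    (.letter (.inr (.neg (.or (.eq .r0 1) (.eq .r1 1)))))

end Pocka

/-! Two invariants meet in a cycle. On the semantic side, an exchange or contraction step turns a
pomset into the image of another under a surjective, monotone, label-preserving map
(`Pomset.Refines`). Such maps preserve the set of labels that occur, the condition "all `a`-nodes
lie below all `b`-nodes", and the existence of a `b`-node above all `a`-nodes. Hence every pomset in
the closure keeps what is visible in the unclosed semantics (`IsLitmus`, `Closure.of_refines`): the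
write to `x` precedes that to `r0`, the write to `y` precedes that to `r1`, and above the writes to
each register there is a state giving it the value `0`.

On the guarded side, induction yields an initial and a final state related as in `Exec`. The
decisive field is `race`: if `v` is written only by `v ← n` and `r` only by `r ← v`, and both are
written, then some write to `r` lies strictly below some write to `v`, or `r` ends with value `n`.
The field `settled` makes both registers end with `0`, so `race` with `n = 1` puts a write to `r0`
strictly below one to `y` and a write to `r1` strictly below one to `x`. This closes the cycle `x ≤
r0 < y ≤ r1 < x`. Strict order is only ever read off the guarded pomset itself, since contraction
could destroy it. -/

namespace Pocka

/-! ### Isomorphism-invariant predicates on pomsets -/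

namespace Pomset

variable {A : Type}

/-- The predicate on pomsets induced by an isomorphism-invariant predicate on labelled posets. -/
def lift (P : LPoset A → Prop) (hP : ∀ u v : LPoset A, u ≈ v → P u → P v) : Pomset A → Prop :=
  Quotient.lift P fun u v h => propext ⟨hP u v h, hP v u (Setoid.symm h)⟩

/-- Some node has a label satisfying `c`. -/
def Has (c : A → Prop) : Pomset A → Prop :=
  lift (fun u => ∃ s, c (u.label s)) <| by
    rintro u v ⟨h, hl⟩ ⟨s, hs⟩
    exact ⟨h s, by rwa [hl]⟩

/-- Every node with a label in `a` is below every node with a label in `b`. -/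
def Before (a b : A → Prop) : Pomset A → Prop :=
  lift (fun u => ∀ s t, a (u.label s) → b (u.label t) → s ≤ t) <| by
    rintro u v ⟨h, hl⟩ H s t hs ht
    have := H (h.symm s) (h.symm t) (by rwa [← hl, h.apply_symm_apply])
      (by rwa [← hl, h.apply_symm_apply])
    exact h.symm.le_iff_le.mp this

/-- Some node with a label in `a` is strictly below some node with a label in `b`. -/
def Below (a b : A → Prop) : Pomset A → Prop :=
  lift (fun u => ∃ s t, a (u.label s) ∧ b (u.label t) ∧ s < t) <| by
    rintro u v ⟨h, hl⟩ ⟨s, t, hs, ht, hst⟩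
    exact ⟨h s, h t, by rwa [hl], by rwa [hl], h.lt_iff_lt.mpr hst⟩

/-- Some node with a label in `b` is above all nodes with a label in `a`. -/
def Caps (a b : A → Prop) : Pomset A → Prop :=
  lift (fun u => ∃ p, b (u.label p) ∧ ∀ s, a (u.label s) → s ≤ p) <| by
    rintro u v ⟨h, hl⟩ ⟨p, hp, H⟩
    refine ⟨h p, by rwa [hl], fun s hs => ?_⟩
    have := H (h.symm s) (by rwa [← hl, h.apply_symm_apply])
    rwa [← h.le_iff_le, h.apply_symm_apply] at this

/-- There is a least node, and it is labelled by `a`. -/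
def IsMin (a : A) : Pomset A → Prop :=
  lift (fun u => ∃ p, u.label p = a ∧ ∀ s, p ≤ s) <| by
    rintro u v ⟨h, hl⟩ ⟨p, hp, H⟩
    refine ⟨h p, by rwa [hl], fun s => ?_⟩
    have := H (h.symm s)
    rwa [← h.le_iff_le, h.apply_symm_apply] at this

/-- There is a greatest node, and it is labelled by `a`. -/
def IsMax (a : A) : Pomset A → Prop :=
  lift (fun u => ∃ p, u.label p = a ∧ ∀ s, s ≤ p) <| by
    rintro u v ⟨h, hl⟩ ⟨p, hp, H⟩
    refine ⟨h p, by rwa [hl], fun s => ?_⟩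
    have := H (h.symm s)
    rwa [← h.le_iff_le, h.apply_symm_apply] at this

/-! ### Behaviour of the predicates under series and parallel composition -/

variable {a b c : A → Prop} {U V : Pomset A}

@[simp]
theorem has_atom {l : A} : (atom l).Has c ↔ c l :=
  ⟨fun ⟨_, h⟩ => h, fun h => ⟨(), h⟩⟩

@[simp]
theorem not_has_one : ¬ (one : Pomset A).Has c :=
  fun ⟨s, _⟩ => Fin.elim0 s

@[simp]
theorem has_seq : (U.seq V).Has c ↔ U.Has c ∨ V.Has c := by
  induction U, V using Quotient.inductionOn₂ with | _ u v
  constructor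
  · rintro ⟨s | s, hs⟩
    · exact Or.inl ⟨s, hs⟩
    · exact Or.inr ⟨s, hs⟩
  · rintro (⟨s, hs⟩ | ⟨s, hs⟩)
    · exact ⟨Sum.inlₗ s, hs⟩
    · exact ⟨Sum.inrₗ s, hs⟩

@[simp]
theorem has_par : (U.par V).Has c ↔ U.Has c ∨ V.Has c := by
  induction U, V using Quotient.inductionOn₂ with | _ u v
  constructor
  · rintro ⟨s | s, hs⟩
    · exact Or.inl ⟨s, hs⟩
    · exact Or.inr ⟨s, hs⟩
  · rintro (⟨s, hs⟩ | ⟨s, hs⟩)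
    · exact ⟨Sum.inl s, hs⟩
    · exact ⟨Sum.inr s, hs⟩

theorem before_of_not_has (h : ¬ U.Has a) : U.Before a b := by
  induction U using Quotient.inductionOn with | _ u
  exact fun s t hs _ => (h ⟨s, hs⟩).elim

@[simp]
theorem before_atom {l : A} : (atom l).Before a b :=
  fun _ _ _ _ => le_refl ()

theorem Before.seq (hU : U.Before a b) (hV : V.Before a b) (h : ¬ (U.Has b ∧ V.Has a)) :
    (U.seq V).Before a b := by
  induction U, V using Quotient.inductionOn₂ with | _ u v
  rintro (s | s) (t | t) hs ht
  · exact Sum.Lex.inl_le_inl_iff.mpr (hU s t hs ht)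
  · exact Sum.Lex.inl_le_inr s t
  · exact (h ⟨⟨t, ht⟩, ⟨s, hs⟩⟩).elim
  · exact Sum.Lex.inr_le_inr_iff.mpr (hV s t hs ht)

theorem Before.par (hU : U.Before a b) (hV : V.Before a b) (h : ¬ (U.Has a ∧ V.Has b))
    (h' : ¬ (U.Has b ∧ V.Has a)) : (U.par V).Before a b := by
  induction U, V using Quotient.inductionOn₂ with | _ u v
  rintro (s | s) (t | t) hs ht
  · exact Sum.inl_le_inl_iff.mpr (hU s t hs ht)
  · exact (h ⟨⟨s, hs⟩, ⟨t, ht⟩⟩).elim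
  · exact (h' ⟨⟨t, ht⟩, ⟨s, hs⟩⟩).elim
  · exact Sum.inr_le_inr_iff.mpr (hV s t hs ht)

theorem below_seq :
    (U.seq V).Below a b ↔ U.Below a b ∨ V.Below a b ∨ U.Has a ∧ V.Has b := by
  induction U, V using Quotient.inductionOn₂ with | _ u v
  constructor
  · rintro ⟨s | s, t | t, hs, ht, hst⟩
    · exact Or.inl ⟨s, t, hs, ht, Sum.Lex.inl_lt_inl_iff.mp hst⟩
    · exact Or.inr (Or.inr ⟨⟨s, hs⟩, ⟨t, ht⟩⟩)
    · exact (Sum.Lex.not_inr_lt_inl hst).elim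
    · exact Or.inr (Or.inl ⟨s, t, hs, ht, Sum.Lex.inr_lt_inr_iff.mp hst⟩)
  · rintro (⟨s, t, hs, ht, hst⟩ | ⟨s, t, hs, ht, hst⟩ | ⟨⟨s, hs⟩, ⟨t, ht⟩⟩)
    · exact ⟨Sum.inlₗ s, Sum.inlₗ t, hs, ht, Sum.Lex.inl_lt_inl_iff.mpr hst⟩
    · exact ⟨Sum.inrₗ s, Sum.inrₗ t, hs, ht, Sum.Lex.inr_lt_inr_iff.mpr hst⟩
    · exact ⟨Sum.inlₗ s, Sum.inrₗ t, hs, ht, Sum.Lex.inl_lt_inr s t⟩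

theorem Below.par_left (h : U.Below a b) : (U.par V).Below a b := by
  induction U, V using Quotient.inductionOn₂ with | _ u v
  obtain ⟨s, t, hs, ht, hst⟩ := h
  exact ⟨Sum.inl s, Sum.inl t, hs, ht, Sum.inl_lt_inl_iff.mpr hst⟩

theorem Below.par_right (h : V.Below a b) : (U.par V).Below a b := by
  induction U, V using Quotient.inductionOn₂ with | _ u v
  obtain ⟨s, t, hs, ht, hst⟩ := h
  exact ⟨Sum.inr s, Sum.inr t, hs, ht, Sum.inr_lt_inr_iff.mpr hst⟩

theorem Below.has_left (h : U.Below a b) : U.Has a := by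
  induction U using Quotient.inductionOn with | _ u
  obtain ⟨s, t, hs, ht, hst⟩ := h
  exact ⟨s, hs⟩

theorem caps_atom {l : A} : (atom l).Caps a b ↔ b l :=
  ⟨fun ⟨_, h, _⟩ => h, fun h => ⟨(), h, fun _ _ => le_refl ()⟩⟩

/-- A witness on the right is above the whole left part for free; a witness on the left is above
nothing on the right, so the right part must be free of `a`. -/
theorem caps_seq : (U.seq V).Caps a b ↔ U.Caps a b ∧ ¬ V.Has a ∨ V.Caps a b := by
  induction U, V using Quotient.inductionOn₂ with | _ u v
  constructor
  · rintro ⟨p | p, hp, H⟩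
    · refine Or.inl ⟨⟨p, hp, fun s hs => ?_⟩, ?_⟩
      · exact Sum.Lex.inl_le_inl_iff.mp (H (Sum.inlₗ s) hs)
      · rintro ⟨s, hs⟩
        exact Sum.Lex.not_inr_le_inl (H (Sum.inrₗ s) hs)
    · refine Or.inr ⟨p, hp, fun s hs => ?_⟩
      exact Sum.Lex.inr_le_inr_iff.mp (H (Sum.inrₗ s) hs)
  · rintro (⟨⟨p, hp, H⟩, h⟩ | ⟨p, hp, H⟩)
    · refine ⟨Sum.inlₗ p, hp, ?_⟩
      rintro (s | s) hs
      · exact Sum.Lex.inl_le_inl_iff.mpr (H s hs)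
      · exact (h ⟨s, hs⟩).elim
    · refine ⟨Sum.inrₗ p, hp, ?_⟩
      rintro (s | s) hs
      · exact Sum.Lex.inl_le_inr s p
      · exact Sum.Lex.inr_le_inr_iff.mpr (H s hs)

theorem Caps.of_par (h : (U.par V).Caps a b) : U.Caps a b ∨ V.Caps a b := by
  induction U, V using Quotient.inductionOn₂ with | _ u v
  obtain ⟨p | p, hp, H⟩ := h
  · exact Or.inl ⟨p, hp, fun s hs => Sum.inl_le_inl_iff.mp (H (Sum.inl s) hs)⟩
  · exact Or.inr ⟨p, hp, fun s hs => Sum.inr_le_inr_iff.mp (H (Sum.inr s) hs)⟩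

theorem isMin_atom (l : A) : (atom l).IsMin l :=
  ⟨(), rfl, fun _ => le_refl ()⟩

theorem isMax_atom (l : A) : (atom l).IsMax l :=
  ⟨(), rfl, fun _ => le_refl ()⟩

theorem IsMin.seq {l : A} (h : U.IsMin l) : (U.seq V).IsMin l := by
  induction U, V using Quotient.inductionOn₂ with | _ u v
  obtain ⟨p, hp, H⟩ := h
  refine ⟨Sum.inlₗ p, hp, ?_⟩
  rintro (s | s)
  · exact Sum.Lex.inl_le_inl_iff.mpr (H s)
  · exact Sum.Lex.inl_le_inr p s

theorem IsMax.seq {l : A} (h : V.IsMax l) : (U.seq V).IsMax l := by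
  induction U, V using Quotient.inductionOn₂ with | _ u v
  obtain ⟨p, hp, H⟩ := h
  refine ⟨Sum.inrₗ p, hp, ?_⟩
  rintro (s | s)
  · exact Sum.Lex.inl_le_inr s p
  · exact Sum.Lex.inr_le_inr_iff.mpr (H s)

/-- `V` may be empty, so the greatest node may lie in `U` and `IsMax.seq` does not apply. This is
the form needed when guarded pomsets are glued along a shared state. -/
theorem IsMax.seq_seq {X : Pomset A} {l : A} (h : (U.seq V).IsMax l) :
    ((X.seq U).seq V).IsMax l := by
  induction U, V using Quotient.inductionOn₂ with | _ u v
  induction X using Quotient.inductionOn with | _ x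
  obtain ⟨p | p, hp, H⟩ := h
  · refine ⟨Sum.inlₗ (Sum.inrₗ p), hp, ?_⟩
    rintro ((s | s) | s)
    · exact Sum.Lex.inl_le_inl_iff.mpr (Sum.Lex.inl_le_inr s p)
    · exact Sum.Lex.inl_le_inl_iff.mpr
        (Sum.Lex.inr_le_inr_iff.mpr (Sum.Lex.inl_le_inl_iff.mp (H (Sum.inlₗ s))))
    · exact (Sum.Lex.not_inr_le_inl (H (Sum.inrₗ s))).elim
  · refine ⟨Sum.inrₗ p, hp, ?_⟩
    rintro (s | s)
    · exact Sum.Lex.inl_le_inr s p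
    · exact Sum.Lex.inr_le_inr_iff.mpr (Sum.Lex.inr_le_inr_iff.mp (H (Sum.inrₗ s)))

theorem IsMin.unique {l m : A} (h : U.IsMin l) (h' : U.IsMin m) : l = m := by
  induction U using Quotient.inductionOn with | _ u
  obtain ⟨p, rfl, H⟩ := h
  obtain ⟨q, rfl, H'⟩ := h'
  rw [le_antisymm (H q) (H' p)]

theorem IsMax.unique {l m : A} (h : U.IsMax l) (h' : U.IsMax m) : l = m := by
  induction U using Quotient.inductionOn with | _ u
  obtain ⟨p, rfl, H⟩ := h
  obtain ⟨q, rfl, H'⟩ := h'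
  rw [le_antisymm (H' p) (H q)]

/-- If `a` is before `b` and `c` is before `d`, then order from `b` to `c` and from `d` to `a` would
form a cycle. -/
theorem not_below_of_before {d : A → Prop} (hab : U.Before a b) (hcd : U.Before c d)
    (hbc : U.Below b c) : ¬ U.Below d a := by
  induction U using Quotient.inductionOn with | _ u
  rintro ⟨s, t, hs, ht, hst⟩
  obtain ⟨p, q, hp, hq, hpq⟩ := hbc
  exact absurd (((hab t p ht hp).trans_lt hpq).trans_le (hcd q s hq hs)) hst.asymm

end Pomset

/-! ### Refinement of pomsets -/

/-- `v` arises from `u` by adding order and identifying nodes with equal labels. -/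
def LPoset.Refines {A : Type} (u v : LPoset A) : Prop :=
  ∃ f : u.carrier → v.carrier, Monotone f ∧ Function.Surjective f ∧
    ∀ s, v.label (f s) = u.label s

namespace Pomset

variable {A : Type} {U V X : Pomset A} {a b c : A → Prop}

/-- `V` arises from `U` by adding order and identifying nodes with equal labels. -/
def Refines (U V : Pomset A) : Prop :=
  ∃ u v : LPoset A, (Quotient.mk _ u : Pomset A) = U ∧ (Quotient.mk _ v : Pomset A) = V ∧
    u.Refines v

theorem Refines.seq_right (h : U.Refines V) : (X.seq U).Refines (X.seq V) := by
  obtain ⟨u, v, rfl, rfl, f, hf, hs, hl⟩ := h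
  induction X using Quotient.inductionOn with | _ x
  refine ⟨x.seq u, x.seq v, rfl, rfl, fun s => toLex (Sum.map id f (ofLex s)), ?_, ?_, ?_⟩
  · rintro (s | s) (t | t) hst
    · exact Sum.Lex.inl_le_inl_iff.mpr (Sum.Lex.inl_le_inl_iff.mp hst)
    · exact Sum.Lex.inl_le_inr _ _
    · exact (Sum.Lex.not_inr_le_inl hst).elim
    · exact Sum.Lex.inr_le_inr_iff.mpr (hf (Sum.Lex.inr_le_inr_iff.mp hst))
  · rintro (s | s)
    · exact ⟨Sum.inlₗ s, rfl⟩
    · obtain ⟨t, rfl⟩ := hs s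
      exact ⟨Sum.inrₗ t, rfl⟩
  · rintro (s | s)
    · rfl
    · exact hl s

theorem Refines.seq_left (h : U.Refines V) : (U.seq X).Refines (V.seq X) := by
  obtain ⟨u, v, rfl, rfl, f, hf, hs, hl⟩ := h
  induction X using Quotient.inductionOn with | _ x
  refine ⟨u.seq x, v.seq x, rfl, rfl, fun s => toLex (Sum.map f id (ofLex s)), ?_, ?_, ?_⟩
  · rintro (s | s) (t | t) hst
    · exact Sum.Lex.inl_le_inl_iff.mpr (hf (Sum.Lex.inl_le_inl_iff.mp hst))
    · exact Sum.Lex.inl_le_inr _ _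
    · exact (Sum.Lex.not_inr_le_inl hst).elim
    · exact Sum.Lex.inr_le_inr_iff.mpr (Sum.Lex.inr_le_inr_iff.mp hst)
  · rintro (s | s)
    · obtain ⟨t, rfl⟩ := hs s
      exact ⟨Sum.inlₗ t, rfl⟩
    · exact ⟨Sum.inrₗ s, rfl⟩
  · rintro (s | s)
    · exact hl s
    · rfl

theorem Refines.par_right (h : U.Refines V) : (X.par U).Refines (X.par V) := by
  obtain ⟨u, v, rfl, rfl, f, hf, hs, hl⟩ := h
  induction X using Quotient.inductionOn with | _ x
  refine ⟨x.par u, x.par v, rfl, rfl, Sum.map id f, ?_,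
    Function.surjective_id.sumMap hs, ?_⟩
  · rintro (s | s) (t | t) hst
    · exact Sum.inl_le_inl_iff.mpr (Sum.inl_le_inl_iff.mp hst)
    · exact (Sum.not_inl_le_inr hst).elim
    · exact (Sum.not_inr_le_inl hst).elim
    · exact Sum.inr_le_inr_iff.mpr (hf (Sum.inr_le_inr_iff.mp hst))
  · rintro (s | s)
    · rfl
    · exact hl s

/-- Refinement is a precongruence, so closure steps can be analysed without their context. -/
theorem Refines.fill (h : U.Refines V) (C : Ctx A) : (C.fill U).Refines (C.fill V) := by
  induction C with
  | hole => exact h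
  | seqLeft X hX C ih => exact ih.seq_right
  | seqRight C X hX ih => exact ih.seq_left
  | par X hX C ih => exact ih.par_right

/-- The map is the bijection exchanging the two middle summands. It keeps the order of `E` before
`G` and of `F` before `H`, and the target merely adds `E` before `H` and `F` before `G`. -/
theorem refines_exchange (E F G H : Pomset A) :
    ((E.seq G).par (F.seq H)).Refines ((E.par F).seq (G.par H)) := by
  induction E, F using Quotient.inductionOn₂ with | _ e f
  induction G, H using Quotient.inductionOn₂ with | _ g h
  refine ⟨(e.seq g).par (f.seq h), (e.par f).seq (g.par h), rfl, rfl,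
    Sum.elim (fun s => toLex (Sum.map Sum.inl Sum.inl (ofLex s)))
      (fun s => toLex (Sum.map Sum.inr Sum.inr (ofLex s))), ?_, ?_, ?_⟩
  · rintro ((s | s) | (s | s)) ((t | t) | (t | t)) hst
    · exact Sum.Lex.inl_le_inl_iff.mpr
        (Sum.inl_le_inl_iff.mpr (Sum.Lex.inl_le_inl_iff.mp (Sum.inl_le_inl_iff.mp hst)))
    · exact Sum.Lex.inl_le_inr _ _
    · exact (Sum.not_inl_le_inr hst).elim
    · exact (Sum.not_inl_le_inr hst).elim
    · exact (Sum.Lex.not_inr_le_inl (Sum.inl_le_inl_iff.mp hst)).elim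
    · exact Sum.Lex.inr_le_inr_iff.mpr
        (Sum.inl_le_inl_iff.mpr (Sum.Lex.inr_le_inr_iff.mp (Sum.inl_le_inl_iff.mp hst)))
    · exact (Sum.not_inl_le_inr hst).elim
    · exact (Sum.not_inl_le_inr hst).elim
    · exact (Sum.not_inr_le_inl hst).elim
    · exact (Sum.not_inr_le_inl hst).elim
    · exact Sum.Lex.inl_le_inl_iff.mpr
        (Sum.inr_le_inr_iff.mpr (Sum.Lex.inl_le_inl_iff.mp (Sum.inr_le_inr_iff.mp hst)))
    · exact Sum.Lex.inl_le_inr _ _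
    · exact (Sum.not_inr_le_inl hst).elim
    · exact (Sum.not_inr_le_inl hst).elim
    · exact (Sum.Lex.not_inr_le_inl (Sum.inr_le_inr_iff.mp hst)).elim
    · exact Sum.Lex.inr_le_inr_iff.mpr
        (Sum.inr_le_inr_iff.mpr (Sum.Lex.inr_le_inr_iff.mp (Sum.inr_le_inr_iff.mp hst)))
  · rintro ((s | s) | (s | s))
    · exact ⟨Sum.inl (Sum.inlₗ s), rfl⟩
    · exact ⟨Sum.inr (Sum.inlₗ s), rfl⟩
    · exact ⟨Sum.inl (Sum.inrₗ s), rfl⟩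
    · exact ⟨Sum.inr (Sum.inrₗ s), rfl⟩
  · rintro ((s | s) | (s | s)) <;> rfl

theorem refines_contract (l : A) : ((atom l).seq (atom l)).Refines (atom l) := by
  refine ⟨(LPoset.single l).seq (LPoset.single l), LPoset.single l, rfl, rfl, fun _ => (), ?_, ?_,
    ?_⟩
  · exact fun _ _ _ => le_refl ()
  · exact fun _ => ⟨Sum.inlₗ (), rfl⟩
  · rintro (s | s) <;> rfl

theorem Refines.has_iff (h : U.Refines V) : V.Has c ↔ U.Has c := by
  obtain ⟨u, v, rfl, rfl, f, hf, hs, hl⟩ := h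
  constructor
  · rintro ⟨t, ht⟩
    obtain ⟨s, rfl⟩ := hs t
    exact ⟨s, by rwa [← hl]⟩
  · rintro ⟨s, h⟩
    exact ⟨f s, by rwa [hl]⟩

/-- Surjectivity lifts both nodes to `U`, and monotonicity carries the comparison back. -/
theorem Refines.before (h : U.Refines V) (hU : U.Before a b) : V.Before a b := by
  obtain ⟨u, v, rfl, rfl, f, hf, hs, hl⟩ := h
  intro s t ha hb
  obtain ⟨s, rfl⟩ := hs s
  obtain ⟨t, rfl⟩ := hs t
  exact hf (hU s t (by rwa [← hl]) (by rwa [← hl]))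

theorem Refines.caps (h : U.Refines V) (hU : U.Caps a b) : V.Caps a b := by
  obtain ⟨u, v, rfl, rfl, f, hf, hs, hl⟩ := h
  obtain ⟨p, hp, H⟩ := hU
  refine ⟨f p, by rwa [hl], fun s ha => ?_⟩
  obtain ⟨s, rfl⟩ := hs s
  exact hf (H s (by rwa [← hl]))

end Pomset

/-- A property of pomsets stable under refinement passes from a language to its closure under
exchange and contraction. -/
theorem Closure.of_refines {Var Val : Type} {L : Set (Pomset (Label Var Val))}
    {P : Pomset (Label Var Val) → Prop} (hL : ∀ U ∈ L, P U)
    (hP : ∀ U V : Pomset (Label Var Val), U.Refines V → P U → P V) {U : Pomset (Label Var Val)}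
    (hU : Closure (exch (Label Var Val) ∪ contr Var Val) L U) : P U := by
  induction hU with
  | base h => exact hL _ h
  | step hH C hf hV ih =>
    rcases hH with ⟨e, f, g, h, rfl⟩ | ⟨α, rfl⟩
    · obtain ⟨_, ⟨E, hE, F, hF, rfl⟩, _, ⟨G, hG, H, hH, rfl⟩, rfl⟩ := hV
      -- The four factors of the new pomset also determine one member of the right-hand side of the
      -- hypothesis; the induction hypothesis is used for that member alone.
      exact hP _ _ ((Pomset.refines_exchange E F G H).fill C)
        (ih _ ⟨_, ⟨E, hE, G, hG, rfl⟩, _, ⟨F, hF, H, hH, rfl⟩, rfl⟩)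
    · obtain rfl := hV
      exact hP _ _ ((Pomset.refines_contract _).fill C) (ih _ ⟨_, rfl, _, rfl, rfl⟩)

/-! ### Executions -/

section Exec

variable {Var Val : Type}

/-- The variable written by an action. -/
def Act.target : Act Var Val → Var
  | .assign v _ => v
  | .copy v _ => v

/-- The label is an action that writes `v`. -/
def Writes (v : Var) : Label Var Val → Prop
  | .inl a => a.target = v
  | .inr _ => False

/-- The label is an action that writes `v` and differs from `a`. -/
def WritesOther (v : Var) (a : Act Var Val) (l : Label Var Val) : Prop :=
  Writes v l ∧ l ≠ .inl a

/-- The label is a state that maps `v` to `n`. -/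
def Maps (v : Var) (n : Val) : Label Var Val → Prop
  | .inl _ => False
  | .inr α => α v = some n

@[simp]
theorem writes_inl {v : Var} {a : Act Var Val} : Writes v (.inl a) ↔ a.target = v := Iff.rfl

@[simp]
theorem not_writes_inr {v : Var} {α : State Var Val} : ¬ Writes v (.inr α) := id

@[simp]
theorem maps_inr {v : Var} {n : Val} {α : State Var Val} : Maps v n (.inr α) ↔ α v = some n :=
  Iff.rfl

@[simp]
theorem not_maps_inl {v : Var} {n : Val} {a : Act Var Val} : ¬ Maps v n (.inl a) := id

/-- Facts about the initial state `α` and the final state `β` of a guarded pomset `U`. -/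
structure Exec (U : Pomset (Label Var Val)) (α β : State Var Val) : Prop where
  frame : ∀ v, ¬ U.Has (Writes v) → β v = α v
  assign : ∀ v n, ¬ U.Has (WritesOther v (.assign v n)) → U.Has (Writes v) → β v = some n
  copy : ∀ r v, ¬ U.Has (Writes v) → ¬ U.Has (WritesOther r (.copy r v)) → U.Has (Writes r) →
    ∃ n, α v = some n ∧ β r = some n
  race : ∀ r v n, ¬ U.Has (WritesOther v (.assign v n)) → ¬ U.Has (WritesOther r (.copy r v)) →
    U.Has (Writes v) → U.Has (Writes r) → U.Below (Writes r) (Writes v) ∨ β r = some n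
  settled : ∀ v n, U.Caps (Writes v) (Maps v n) → β v = some n

namespace Exec

variable {U V : Pomset (Label Var Val)} {α β γ δ : State Var Val}

theorem state (α : State Var Val) : Exec (statePom α) α α where
  frame _ _ := rfl
  assign v n _ h := by simp [statePom] at h
  copy r v _ _ h := by simp [statePom] at h
  race r v n _ _ h := by simp [statePom] at h
  settled v n h := by simpa [statePom, Pomset.caps_atom] using h

theorem act [DecidableEq Var] {a : Act Var Val} (h : α.update a = some β) :
    Exec (actPom a) α β where
  frame v hv := by
    simp only [actPom, Pomset.has_atom, writes_inl] at hv
    rcases a with ⟨w, n⟩ | ⟨w, w'⟩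
    · simp only [State.update, Option.some.injEq] at h
      simp [← h, Act.target] at hv ⊢
      grind
    · simp only [State.update] at h
      simp only [Act.target] at hv
      split at h <;> simp at h
      grind
  assign v n hv hw := by
    simp only [actPom, Pomset.has_atom, writes_inl, WritesOther] at hv hw
    obtain rfl : a = .assign v n := by simpa [hw] using hv
    simp only [State.update, Option.some.injEq] at h
    simp [← h]
  copy r v _ hr hw := by
    simp only [actPom, Pomset.has_atom, writes_inl, WritesOther] at hr hw
    obtain rfl : a = .copy r v := by simpa [hw] using hr
    simp only [State.update] at h
    split at h <;> simp at h
    rename_i n hn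
    exact ⟨n, hn, by simp [← h]⟩
  -- A single action would have to be both an assignment and a copy.
  race r v n hv hr hwv hwr := by
    simp only [actPom, Pomset.has_atom, writes_inl, WritesOther] at hv hr hwv hwr
    have h₁ : a = .copy r v := by simpa [hwr] using hr
    have h₂ : a = .assign v n := by simpa [hwv] using hv
    simp [h₁] at h₂
  settled v n hc := by simp [actPom, Pomset.caps_atom] at hc

theorem seq (hU : Exec U α β) (hV : Exec V β γ) : Exec (U.seq V) α γ where
  frame v h := by
    rw [Pomset.has_seq, not_or] at h
    rw [hV.frame v h.2, hU.frame v h.1]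
  assign v n h hw := by
    rw [Pomset.has_seq, not_or] at h
    by_cases hv : V.Has (Writes v)
    · exact hV.assign v n h.2 hv
    · rw [hV.frame v hv]
      exact hU.assign v n h.1 ((Pomset.has_seq.mp hw).resolve_right hv)
  copy r v h hr hw := by
    rw [Pomset.has_seq, not_or] at h hr
    by_cases hv : V.Has (Writes r)
    · rw [← hU.frame v h.1]
      exact hV.copy r v h.2 hr.2 hv
    · rw [hV.frame r hv]
      exact hU.copy r v h.1 hr.1 ((Pomset.has_seq.mp hw).resolve_right hv)
  race r v n h hr hwv hwr := by
    rw [Pomset.has_seq, not_or] at h hr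
    rw [Pomset.has_seq] at hwv hwr
    rw [Pomset.below_seq]
    -- If `V` writes both or neither, the race is decided in `V` or in `U`. If `V` writes only `v`,
    -- then `r` is written in `U`, which gives the order. If `V` writes only `r`, it reads the value
    -- `n` that `U` left in `v`.
    by_cases hVv : V.Has (Writes v) <;> by_cases hVr : V.Has (Writes r)
    · have := hV.race r v n h.2 hr.2 hVv hVr
      tauto
    · tauto
    · obtain ⟨m, hm, hm'⟩ := hV.copy r v hVv hr.2 hVr
      rw [hU.assign v n h.1 (hwv.resolve_right hVv)] at hm
      exact Or.inr (hm'.trans hm.symm)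
    · rw [hV.frame r hVr]
      have := hU.race r v n h.1 hr.1 (hwv.resolve_right hVv) (hwr.resolve_right hVr)
      tauto
  settled v n h := by
    rcases Pomset.caps_seq.mp h with ⟨h, hv⟩ | h
    · rw [hV.frame v hv, hU.settled v n h]
    · exact hV.settled v n h

end Exec

theorem State.union_eq_left {α β : State Var Val} {v : Var} {n : Val} (h : α v = some n) :
    α.union β v = some n := by
  simp [State.union, h]

theorem State.union_eq_right {α β : State Var Val} (hc : α.Compatible β) {v : Var} {n : Val}
    (h : β v = some n) : α.union β v = some n := by
  rcases hα : α v with _ | m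
  · simp [State.union, h, hα]
  · rw [State.union_eq_left hα, hc v m n hα h]

namespace Exec

variable {U V : Pomset (Label Var Val)} {α β γ δ : State Var Val}

/-- Compatibility of the states at the fork and at the join lets each thread's conclusions survive
in the union. -/
theorem par (hU : Exec U α β) (hV : Exec V γ δ) (hαγ : α.Compatible γ) (hβδ : β.Compatible δ) :
    Exec (U.par V) (α.union γ) (β.union δ) where
  frame v h := by
    rw [Pomset.has_par, not_or] at h
    rw [State.union, State.union, hU.frame v h.1, hV.frame v h.2]
  assign v n h hw := by
    rw [Pomset.has_par, not_or] at h
    rcases Pomset.has_par.mp hw with hw | hw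
    · exact State.union_eq_left (hU.assign v n h.1 hw)
    · exact State.union_eq_right hβδ (hV.assign v n h.2 hw)
  copy r v h hr hw := by
    rw [Pomset.has_par, not_or] at h hr
    rcases Pomset.has_par.mp hw with hw | hw
    · obtain ⟨n, hα, hβ⟩ := hU.copy r v h.1 hr.1 hw
      exact ⟨n, State.union_eq_left hα, State.union_eq_left hβ⟩
    · obtain ⟨n, hγ, hδ⟩ := hV.copy r v h.2 hr.2 hw
      exact ⟨n, State.union_eq_right hαγ hγ, State.union_eq_right hβδ hδ⟩
  race r v n h hr hwv hwr := by
    rw [Pomset.has_par, not_or] at h hr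
    rw [Pomset.has_par] at hwv hwr
    by_cases hUr : U.Has (Writes r)
    · by_cases hUv : U.Has (Writes v)
      · exact (hU.race r v n h.1 hr.1 hUv hUr).imp Pomset.Below.par_left State.union_eq_left
      -- `U` reads `v` without writing it, so it still holds the value read when it ends, while `V`
      -- ends with `v = n`. Compatibility at the join forces the two values to agree.
      · obtain ⟨m, hα, hβ⟩ := hU.copy r v hUv hr.1 hUr
        rw [← hU.frame v hUv] at hα
        obtain rfl := hβδ v m n hα (hV.assign v n h.2 (hwv.resolve_left hUv))
        exact Or.inr (State.union_eq_left hβ)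
    · have hVr := hwr.resolve_left hUr
      by_cases hVv : V.Has (Writes v)
      · exact (hV.race r v n h.2 hr.2 hVv hVr).imp Pomset.Below.par_right
          (State.union_eq_right hβδ)
      · obtain ⟨m, hγ, hδ⟩ := hV.copy r v hVv hr.2 hVr
        rw [← hV.frame v hVv] at hγ
        obtain rfl := hβδ v n m (hU.assign v n h.1 (hwv.resolve_right hVv)) hγ
        exact Or.inr (State.union_eq_right hβδ hδ)
  settled v n h := by
    rcases h.of_par with h | h
    · exact State.union_eq_left (hU.settled v n h)
    · exact State.union_eq_right hβδ (hV.settled v n h)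

/-- `Exec` sees state nodes only through `settled`, so it transfers between pomsets with the same
action labels once `Below` and `Caps` are controlled in the directions given. -/
theorem of_has_iff {W : Pomset (Label Var Val)}
    (hW : ∀ c : Label Var Val → Prop, (∀ σ, ¬ c (.inr σ)) → (U.Has c ↔ W.Has c))
    (hb : ∀ v w, W.Below (Writes v) (Writes w) → U.Below (Writes v) (Writes w))
    (hc : ∀ v n, U.Caps (Writes v) (Maps v n) → W.Caps (Writes v) (Maps v n))
    (h : Exec W α β) : Exec U α β := by
  have h₁ (v : Var) : U.Has (Writes v) ↔ W.Has (Writes v) := hW _ fun _ => id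
  have h₂ (v : Var) (a : Act Var Val) : U.Has (WritesOther v a) ↔ W.Has (WritesOther v a) :=
    hW _ fun _ h => h.1
  refine ⟨fun v => ?_, fun v n => ?_, fun r v => ?_, fun r v n => ?_, fun v n hU => ?_⟩
  · rw [h₁]
    exact h.frame v
  · rw [h₁, h₂]
    exact h.assign v n
  · rw [h₁, h₁, h₂]
    exact h.copy r v
  · rw [h₁, h₁, h₂, h₂]
    exact fun i j k l => (h.race r v n i j k l).imp_left (hb r v)
  · exact h.settled v n (hc v n hU)

theorem not_below_state {v w : Var} {σ : State Var Val} :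
    ¬ (Pomset.atom (Sum.inr σ)).Below (Writes (Val := Val) v) (Writes w) :=
  fun h => by simpa using h.has_left

/-- The parallel rule for guarded pomsets composes the bodies without their bounding states, so
these must be removable. -/
theorem of_seq_state {σ : State Var Val} (h : Exec (U.seq (statePom σ)) α β) : Exec U α β := by
  refine h.of_has_iff (fun c hc => ?_) (fun v w hb => ?_) (fun v n hc => ?_)
  · simp [statePom, hc]
  · simpa [Pomset.below_seq, not_below_state, statePom] using hb
  · exact Pomset.caps_seq.mpr (Or.inl ⟨hc, by simp [statePom]⟩)

theorem of_state_seq {σ : State Var Val} (h : Exec ((statePom σ).seq U) α β) : Exec U α β := by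
  refine h.of_has_iff (fun c hc => ?_) (fun v w hb => ?_) (fun v n hc => ?_)
  · simp [statePom, hc]
  · simpa [Pomset.below_seq, not_below_state, statePom] using hb
  · exact Pomset.caps_seq.mpr (Or.inr hc)

end Exec

/-- A guarded pomset runs from the label of its least node to the label of its greatest node. -/
theorem Guarded.exists_exec [DecidableEq Var] {U : Pomset (Label Var Val)} (h : Guarded U) :
    ∃ α β : State Var Val, U.IsMin (.inr α) ∧ U.IsMax (.inr β) ∧ Exec U α β := by
  induction h with
  | state α => exact ⟨α, α, Pomset.isMin_atom _, Pomset.isMax_atom _, .state α⟩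
  | action α a β h =>
    exact ⟨α, β, (Pomset.isMin_atom _).seq.seq, (Pomset.isMax_atom _).seq,
      ((Exec.state α).seq (.act h)).seq (.state β)⟩
  | seq U V σ _ _ hU hV =>
    obtain ⟨α, β, hα, hβ, hU⟩ := hU
    obtain ⟨γ, δ, hγ, hδ, hV⟩ := hV
    -- Least and greatest nodes are unique, so the end states supplied by induction are those
    -- displayed in the rule.
    obtain rfl : β = σ := Sum.inr_injective (hβ.unique (Pomset.isMax_atom (Sum.inr σ)).seq)
    obtain rfl : γ = β := Sum.inr_injective (hγ.unique (Pomset.isMin_atom (Sum.inr β)).seq)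
    exact ⟨α, δ, hα.seq, hδ.seq_seq, hU.seq hV.of_state_seq⟩
  | par U V α β γ δ _ _ hαγ hβδ hU hV =>
    obtain ⟨α', β', hα, hβ, hU⟩ := hU
    obtain ⟨γ', δ', hγ, hδ, hV⟩ := hV
    obtain rfl : β' = β := Sum.inr_injective (hβ.unique (Pomset.isMax_atom (Sum.inr β)).seq)
    obtain rfl : δ' = δ := Sum.inr_injective (hδ.unique (Pomset.isMax_atom (Sum.inr δ)).seq)
    obtain rfl : α' = α := Sum.inr_injective (hα.unique (Pomset.isMin_atom (Sum.inr α)).seq.seq)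
    obtain rfl : γ' = γ := Sum.inr_injective (hγ.unique (Pomset.isMin_atom (Sum.inr γ)).seq.seq)
    exact ⟨_, _, (Pomset.isMin_atom _).seq.seq, (Pomset.isMax_atom _).seq,
      ((Exec.state _).seq
        (hU.of_seq_state.of_state_seq.par hV.of_seq_state.of_state_seq hαγ hβδ)).seq (.state _)⟩

end Exec

/-! ### The litmus test -/

section Litmus

variable {Var Val : Type}

/-! ### Nodes and order in the unclosed semantics -/

theorem not_has_of_mem_star {c : Label Var Val → Prop} (hc : ∀ σ, ¬ c (.inr σ))
    {S : Pomset (Label Var Val)} (hS : S ∈ Lang.star (Set.range statePom)) : ¬ S.Has c := by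
  obtain ⟨n, hn⟩ := Set.mem_iUnion.mp hS
  induction n generalizing S with
  | zero =>
    obtain rfl := hn
    exact Pomset.not_has_one
  | succ n ih =>
    obtain ⟨X, hX, _, ⟨σ, rfl⟩, rfl⟩ := hn
    simp [ih (Set.mem_iUnion.mpr ⟨n, hX⟩) hX, statePom, hc]

theorem has_iff_of_mem_padStates_act {c : Label Var Val → Prop} (hc : ∀ σ, ¬ c (.inr σ))
    {a : Act Var Val} {U : Pomset (Label Var Val)} (hU : U ∈ padStates {actPom a}) :
    U.Has c ↔ c (.inl a) := by
  obtain ⟨_, ⟨S, hS, _, rfl, rfl⟩, T, hT, rfl⟩ := hU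
  simp [not_has_of_mem_star hc hS, not_has_of_mem_star hc hT, actPom]

theorem not_has_of_mem_padStates_state {c : Label Var Val → Prop} (hc : ∀ σ, ¬ c (.inr σ))
    {Z : Set (State Var Val)} {U : Pomset (Label Var Val)}
    (hU : U ∈ padStates (statePom '' Z)) : ¬ U.Has c := by
  obtain ⟨_, ⟨S, hS, _, ⟨σ, -, rfl⟩, rfl⟩, T, hT, rfl⟩ := hU
  simp [not_has_of_mem_star hc hS, not_has_of_mem_star hc hT, statePom, hc]

theorem caps_of_mem_padStates_state {v : Var} {n : Val} {Z : Set (State Var Val)}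
    (hZ : ∀ σ ∈ Z, σ v = some n) {U : Pomset (Label Var Val)}
    (hU : U ∈ padStates (statePom '' Z)) : U.Caps (Writes v) (Maps v n) := by
  obtain ⟨_, ⟨S, hS, _, ⟨σ, hσ, rfl⟩, rfl⟩, T, hT, rfl⟩ := hU
  refine Pomset.caps_seq.mpr (Or.inl ⟨Pomset.caps_seq.mpr (Or.inr ?_), ?_⟩)
  · exact Pomset.caps_atom.mpr (hZ σ hσ)
  · exact not_has_of_mem_star (fun _ => id) hT

/-- If `p` covers `v = 1`, then a state in the pseudocomplement of `p` has the value `0` at `v`. -/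
theorem State.eq_zero_of_mem_neg {p : Obs LVar LVal} {v : LVar}
    (hp : (Obs.eq v 1).sem ⊆ p.sem) {σ : State LVar LVal} (hσ : σ ∈ (Obs.neg p).sem) :
    σ v = some 0 := by
  obtain ⟨Z, ⟨hZ, hd⟩, hσ⟩ := hσ
  have key : ∀ τ : State LVar LVal, τ.Le σ → τ v ≠ some 1 := fun τ hτ h =>
    Set.eq_empty_iff_forall_notMem.mp hd τ ⟨hp h, hZ τ σ hτ hσ⟩
  rcases h : σ v with _ | n
  · refine (key (Function.update σ v (some 1)) (fun w m hw => ?_) (by simp)).elim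
    rw [Function.update_of_ne, hw]
    rintro rfl
    simp [h] at hw
  · have := key σ (fun _ _ => id)
    rw [h] at this
    have : n ≠ 1 := fun e => this (congrArg some e)
    rw [(by decide : ∀ n : LVal, n ≠ 1 → n = 0) n this]

theorem caps_of_mem_padStates_neg {p : Obs LVar LVal} {v : LVar}
    (hp : (Obs.eq v 1).sem ⊆ p.sem) {U : Pomset (Label LVar LVal)}
    (hU : U ∈ padStates (statePom '' (Obs.neg p).sem)) : U.Caps (Writes v) (Maps v 0) := by
  refine caps_of_mem_padStates_state (Z := (Obs.neg p).sem) ?_ hU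
  intro σ hσ
  exact State.eq_zero_of_mem_neg hp hσ

/-- Two actions in sequence. -/
abbrev actSeq (a b : Act Var Val) : PTerm Var Val := .seq (.letter (.inl a)) (.letter (.inl b))

theorem has_iff_of_mem_actSeq {c : Label Var Val → Prop} (hc : ∀ σ, ¬ c (.inr σ))
    {a b : Act Var Val} {U : Pomset (Label Var Val)} (hU : U ∈ rsem (actSeq a b)) :
    U.Has c ↔ c (.inl a) ∨ c (.inl b) := by
  obtain ⟨X, hX, Y, hY, rfl⟩ := hU
  rw [Pomset.has_seq, has_iff_of_mem_padStates_act hc hX, has_iff_of_mem_padStates_act hc hY]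

/-- There is only one action node, and the padding satisfies neither predicate, so the comparison is
reflexivity. -/
theorem before_of_mem_padStates_act {c d : Label Var Val → Prop} (hc : ∀ σ, ¬ c (.inr σ))
    (hd : ∀ σ, ¬ d (.inr σ)) {a : Act Var Val} {U : Pomset (Label Var Val)}
    (hU : U ∈ padStates {actPom a}) : U.Before c d := by
  obtain ⟨_, ⟨S, hS, _, rfl, rfl⟩, T, hT, rfl⟩ := hU
  have h := not_has_of_mem_star hc hT
  refine Pomset.Before.seq ?_ (Pomset.before_of_not_has h) fun h' => h h'.2
  exact (Pomset.before_of_not_has (not_has_of_mem_star hc hS)).seq Pomset.before_atom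
    fun h' => not_has_of_mem_star hd hS h'.1

/-- As `b` does not write `v`, writes to `v` can occur only in the first factor. -/
theorem before_of_mem_actSeq {a b : Act Var Val} {v w : Var} (hb : b.target ≠ v)
    {U : Pomset (Label Var Val)} (hU : U ∈ rsem (actSeq a b)) :
    U.Before (Writes v) (Writes w) := by
  obtain ⟨X, hX, Y, hY, rfl⟩ := hU
  refine (before_of_mem_padStates_act (fun _ => id) (fun _ => id) hX).seq
    (before_of_mem_padStates_act (fun _ => id) (fun _ => id) hY) fun h => hb ?_
  exact (has_iff_of_mem_padStates_act (fun _ => id) hY).mp h.2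

/-- The properties of the pomsets of the litmus test that rule out a guarded execution. -/
structure IsLitmus (U : Pomset (Label LVar LVal)) : Prop where
  has (v : LVar) : U.Has (Writes v)
  assign_x : ¬ U.Has (WritesOther .x (.assign .x 1))
  assign_y : ¬ U.Has (WritesOther .y (.assign .y 1))
  copy_r0 : ¬ U.Has (WritesOther .r0 (.copy .r0 .y))
  copy_r1 : ¬ U.Has (WritesOther .r1 (.copy .r1 .x))
  before_r0 : U.Before (Writes .x) (Writes .r0)
  before_r1 : U.Before (Writes .y) (Writes .r1)
  caps_r0 : U.Caps (Writes .r0) (Maps .r0 0)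
  caps_r1 : U.Caps (Writes .r1) (Maps .r1 0)

theorem IsLitmus.of_refines {U V : Pomset (Label LVar LVal)} (h : U.Refines V)
    (hU : IsLitmus U) : IsLitmus V where
  has v := h.has_iff.mpr (hU.has v)
  assign_x := h.has_iff.not.mpr hU.assign_x
  assign_y := h.has_iff.not.mpr hU.assign_y
  copy_r0 := h.has_iff.not.mpr hU.copy_r0
  copy_r1 := h.has_iff.not.mpr hU.copy_r1
  before_r0 := h.before hU.before_r0
  before_r1 := h.before hU.before_r1
  caps_r0 := h.caps hU.caps_r0
  caps_r1 := h.caps hU.caps_r1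

theorem rsem_litmus :
    rsem litmus = Lang.seq
      (Lang.seq (padStates (statePom '' (Obs.and (.eq .r0 0) (.eq .r1 0)).sem))
        (Lang.par (rsem (actSeq (.assign .x 1) (.copy .r0 .y)))
          (rsem (actSeq (.assign .y 1) (.copy .r1 .x)))))
      (padStates (statePom '' (Obs.neg (.or (.eq .r0 1) (.eq .r1 1))).sem)) := rfl

/-- The initial observation is an arbitrary `Z`: the contradiction never uses the starting values of
the registers. -/
theorem isLitmus_of_mem {Z : Set (State LVar LVal)} {P S T Q : Pomset (Label LVar LVal)}
    (hP : P ∈ padStates (statePom '' Z))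
    (hS : S ∈ rsem (actSeq (.assign .x 1) (.copy .r0 .y)))
    (hT : T ∈ rsem (actSeq (.assign .y 1) (.copy .r1 .x)))
    (hQ : Q ∈ padStates (statePom '' (Obs.neg (.or (.eq .r0 1) (.eq .r1 1))).sem)) :
    IsLitmus ((P.seq (S.par T)).seq Q) := by
  have has_iff {c : Label LVar LVal → Prop} (hc : ∀ σ, ¬ c (.inr σ)) :
      ((P.seq (S.par T)).seq Q).Has c ↔
        (c (.inl (.assign .x 1)) ∨ c (.inl (.copy .r0 .y))) ∨
          (c (.inl (.assign .y 1)) ∨ c (.inl (.copy .r1 .x))) := by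
    simp [not_has_of_mem_padStates_state hc hP, not_has_of_mem_padStates_state hc hQ,
      has_iff_of_mem_actSeq hc hS, has_iff_of_mem_actSeq hc hT]
  have has_other (v : LVar) (a : Act LVar LVal) := has_iff (c := WritesOther v a) fun _ h => h.1
  have before (v w : LVar) (hvw : v = .x ∧ w = .r0 ∨ v = .y ∧ w = .r1) :
      ((P.seq (S.par T)).seq Q).Before (Writes v) (Writes w) := by
    have hP' := not_has_of_mem_padStates_state (c := Writes v) (fun _ => id) hP
    have hP'' := not_has_of_mem_padStates_state (c := Writes w) (fun _ => id) hP
    have hQ' := not_has_of_mem_padStates_state (c := Writes v) (fun _ => id) hQ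
    refine Pomset.Before.seq (Pomset.Before.seq (Pomset.before_of_not_has hP') ?_
      fun h => hP'' h.1) (Pomset.before_of_not_has hQ') fun h => hQ' h.2
    refine Pomset.Before.par (before_of_mem_actSeq ?_ hS) (before_of_mem_actSeq ?_ hT) ?_ ?_
    · rcases hvw with ⟨rfl, -⟩ | ⟨rfl, -⟩ <;> simp [Act.target]
    · rcases hvw with ⟨rfl, -⟩ | ⟨rfl, -⟩ <;> simp [Act.target]
    all_goals
      rw [has_iff_of_mem_actSeq (fun _ => id) hS, has_iff_of_mem_actSeq (fun _ => id) hT]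
      rcases hvw with ⟨rfl, rfl⟩ | ⟨rfl, rfl⟩ <;> simp [Act.target]
  refine ⟨fun v => ?_, ?_, ?_, ?_, ?_, ?_, ?_, ?_, ?_⟩
  · rw [has_iff fun _ => id]
    cases v <;> simp [Act.target]
  · simp [has_other, WritesOther, Act.target]
  · simp [has_other, WritesOther, Act.target]
  · simp [has_other, WritesOther, Act.target]
  · simp [has_other, WritesOther, Act.target]
  · exact before _ _ (by simp)
  · exact before _ _ (by simp)
  · exact Pomset.caps_seq.mpr (Or.inr (caps_of_mem_padStates_neg Set.subset_union_left hQ))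
  · exact Pomset.caps_seq.mpr (Or.inr (caps_of_mem_padStates_neg Set.subset_union_right hQ))

theorem isLitmus_of_mem_rsem {U : Pomset (Label LVar LVal)} (hU : U ∈ rsem litmus) :
    IsLitmus U := by
  rw [rsem_litmus] at hU
  obtain ⟨_, ⟨P, hP, _, ⟨S, hS, T, hT, rfl⟩, rfl⟩, Q, hQ, rfl⟩ := hU
  exact isLitmus_of_mem hP hS hT hQ

theorem IsLitmus.not_guarded {U : Pomset (Label LVar LVal)} (hU : IsLitmus U) :
    ¬ Guarded U := by
  intro h
  obtain ⟨α, β, -, -, hE⟩ := h.exists_exec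
  have h₀ := hE.settled _ _ hU.caps_r0
  have h₁ := hE.settled _ _ hU.caps_r1
  have b₀ := (hE.race _ _ _ hU.assign_y hU.copy_r0 (hU.has _) (hU.has _)).resolve_right
    (by simp [h₀])
  have b₁ := (hE.race _ _ _ hU.assign_x hU.copy_r1 (hU.has _) (hU.has _)).resolve_right
    (by simp [h₁])
  -- The cycle `x ≤ r0 < y ≤ r1 < x`.
  exact Pomset.not_below_of_before hU.before_r0 hU.before_r1 b₀ b₁

end Litmus

end Pocka

/-- The POCKA semantics of the store-buffering litmus test contains no guarded pomset. -/
theorem mainTheorem5 :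
    Pocka.pockaSem Pocka.litmus ∩ Pocka.guardedPomsets Pocka.LVar Pocka.LVal = ∅ := by
  rw [Set.eq_empty_iff_forall_notMem]
  rintro U ⟨hU, hG⟩
  refine Pocka.IsLitmus.not_guarded ?_ hG
  exact Pocka.Closure.of_refines (fun _ => Pocka.isLitmus_of_mem_rsem)
    (fun _ _ => Pocka.IsLitmus.of_refines) hU
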